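/- Fix $r>0$, $\tfrac12<\beta<1$, $\sigma>0$. For $N\ge 1$ put $p=N^{-\beta}$, $\mu=\sqrt{2r\log N}$ and let $\mathcal T=\mathcal T_N$ be a horizon with $\mathcal T_N/\log N\to 0$. One observes $N$ streams $(X_{n,t})_{t\ge1}$, $n=1,\dots,N$. Under $H_0^{(N)}$ all observations are independent $\mathcal N(0,1)$. Under $H_1^{(N)}$ with change-point $\tau\in\{1,\dots,\mathcal T_N\}$, a random set $I\subset\{1,\dots,N\}$ contains each index independently with probability $p$, and given $I$ all observations are independent, with $X_{n,t}\sim\mathcal N(\mu,\sigma^2)$ if $n\in I$ and $t\ge\tau$, and $X_{n,t}\sim\mathcal N(0,1)$ otherwise. With $S_{n,t}=\sum_{j=1}^tX_{n,j}$ let $$Y^{\mathsf{LR}}_{n,t}=\max_{0\le k\le t}\Bigl(S_{n,t}-S_{n,k}-\tfrac{\mu}{2}(t-k)\Bigr)\mu,\qquad Y^{\mathsf{GLR}}_{n,t}=\max_{t-w<k\le t,\ k\ge0}\frac{|S_{n,t}-S_{n,k}|}{\sqrt{t-k}}$$ (the term $k=t$ of the latter is read as $0$; $w=w_N\ge1$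 is an arbitrary integer window length). For $\square\in\{\mathsf{LR},\mathsf{GLR}\}$ define the P-values $\pi_{n,t}=\pi^\square_t(Y^\square_{n,t})$, where $\pi^\square_t(y)=\Pr(Y^\square_{n,t}\ge y\mid H_0^{(N)})$. Let $$\rho^*(\beta,\sigma)=\begin{cases}(2-\sigma^2)(\beta-\frac12),&\sigma^2<2,\ \beta<1-\sigma^2/4,\\ 0,&\sigma^2\ge2,\ \beta<1-1/\sigma^2,\\ (1-\sigma\sqrt{1-\beta})^2,&\text{otherwise,}\end{cases}\qquad \Delta^*(r,\beta,\sigma)=\lceil\rho^*(\beta,\sigma)/r\rceil .$$ Let $U_t=U^{(N)}_t(\pi_{1,t},\dots,\pi_{N,t})$ be arbitrary real-valued (measurable) test statistics, let $\{b_t^{(N)}\}$ be any array of real thresholds, and let $T_U=\inf\{1\le t\le\mathcal T_N: U_t>b^{(N)}_t\}$ (with $\inf\emptyset=\infty$). Let $\tau=\tau_N\in\{1,\dots,\mathcal T_N\}$ and $t=t_N\ge0$ be integers, possibly varying with $N$, such that for all large $N$ the number $[t-\tau+1]_+$ of post-change observation times up to $t$ is either $0$ or strictly less than $\Delta^*(r,\beta,\sigma)$.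 Then $$\Pr(T_U\le t\mid H_1^{(N)})-\Pr(T_U\le t\mid H_0^{(N)})\to0\qquad(N\to\infty).$$ -/

import Mathlib

open MeasureTheory ProbabilityTheory Filter Topology

noncomputable section

namespace SparseChange

/-- Law of one stream that is never affected: independent `N(0,1)` observations.
A stream is a function of time; the observation times are `1, 2, …` and the value at `0` is never
used. -/
def nullStream : Measure (ℕ → ℝ) :=
  Measure.infinitePi (fun _ : ℕ => gaussianReal 0 1)

/-- Law of one affected stream with change-point `τ`: independent observations, `N(0,1)` at times
`< τ` and `N(μ, σ²)` at times `≥ τ`. -/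
def changedStream (μ σ : ℝ) (τ : ℕ) : Measure (ℕ → ℝ) :=
  Measure.infinitePi (fun j : ℕ =>
    gaussianReal (if j < τ then 0 else μ) (if j < τ then 1 else ⟨σ ^ 2, sq_nonneg σ⟩))

/-- Joint law of the `N` streams under the global null (no change within the horizon). -/
def lawH0 (N : ℕ) : Measure (Fin N → ℕ → ℝ) :=
  Measure.pi (fun _ => nullStream)

/-- Joint law of the `N` streams given that exactly the streams in `I` are affected, at time `τ`. -/
def lawGiven {N : ℕ} (μ σ : ℝ) (τ : ℕ) (I : Finset (Fin N)) : Measure (Fin N → ℕ → ℝ) :=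
  Measure.pi (fun n => if n ∈ I then changedStream μ σ τ else nullStream)

/-- Joint law of the `N` streams under the alternative with change-point `τ`: the affected set `I`
is random and contains every index independently with probability `p`. -/
def lawH1 (N : ℕ) (p μ σ : ℝ) (τ : ℕ) : Measure (Fin N → ℕ → ℝ) :=
  ∑ I : Finset (Fin N),
    ENNReal.ofReal (p ^ I.card * (1 - p) ^ (N - I.card)) • lawGiven μ σ τ I

/-- The partial sum `S_t = x_1 + ⋯ + x_t`. -/
def partialSum (x : ℕ → ℝ) (t : ℕ) : ℝ := ∑ j ∈ Finset.Icc 1 t, x j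

/-- CUSUM (likelihood-ratio) statistic, `max_{0 ≤ k ≤ t} (S_t - S_k - (μ/2)(t-k)) μ`. -/
def lrStat (μ : ℝ) (t : ℕ) (x : ℕ → ℝ) : ℝ :=
  (Finset.Icc 0 t).sup' ⟨t, by simp⟩
    (fun k => (partialSum x t - partialSum x k - μ / 2 * ((t : ℝ) - k)) * μ)

/-- Window-limited generalized likelihood-ratio statistic,
`max_{t-w < k ≤ t, 0 ≤ k} |S_t - S_k| / √(t-k)`. The (degenerate) term `k = t` is `0`, so it
does not affect the maximum of the other, nonnegative, terms. -/
def glrStat (w : ℕ+) (t : ℕ) (x : ℕ → ℝ) : ℝ :=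
  (Finset.Icc (t + 1 - (w : ℕ)) t).sup'
    ⟨t, by have := w.pos; simp only [Finset.mem_Icc]; omega⟩
    (fun k => |partialSum x t - partialSum x k| / Real.sqrt ((t : ℝ) - k))

/-- The two kinds of single-stream tests. -/
inductive TestKind where
  | LR
  | GLR

/-- The single-stream statistic of the given kind at time `t`. -/
def streamStat (kind : TestKind) (μ : ℝ) (w : ℕ+) (t : ℕ) (x : ℕ → ℝ) : ℝ :=
  match kind with
  | TestKind.LR => lrStat μ t x
  | TestKind.GLR => glrStat w t x

/-- The survival function at `y` of the single-stream statistic at time `t` under no change. -/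
def survival (kind : TestKind) (μ : ℝ) (w : ℕ+) (t : ℕ) (y : ℝ) : ℝ :=
  nullStream.real {x | y ≤ streamStat kind μ w t x}

/-- The P-values `π_{1,t}, …, π_{N,t}` of the `N` streams at time `t`. -/
def pValues {N : ℕ} (kind : TestKind) (μ : ℝ) (w : ℕ+) (t : ℕ) (X : Fin N → ℕ → ℝ) : Fin N → ℝ :=
  fun n => survival kind μ w t (streamStat kind μ w t (X n))

/-- The first time `s ∈ {1, …, H}` at which the statistic `U s` of the P-values of time `s` exceeds
the threshold `b s`; it is `⊤` if there is no such time. -/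
def stopTime {N : ℕ} (kind : TestKind) (μ : ℝ) (w : ℕ+) (H : ℕ) (U : ℕ → (Fin N → ℝ) → ℝ)
    (b : ℕ → ℝ) (X : Fin N → ℕ → ℝ) : ℕ∞ :=
  sInf ((fun s : ℕ => (s : ℕ∞)) '' {s : ℕ | 1 ≤ s ∧ s ≤ H ∧ b s < U s (pValues kind μ w s X)})

/-- The detection boundary `ρ*(β, σ)` for `1/2 < β < 1` and `σ > 0`. -/
def rhoStar (β σ : ℝ) : ℝ :=
  if σ ^ 2 < 2 then
    if β < 1 - σ ^ 2 / 4 then (2 - σ ^ 2) * (β - 1 / 2) else (1 - σ * Real.sqrt (1 - β)) ^ 2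
  else
    if β < 1 - 1 / σ ^ 2 then 0 else (1 - σ * Real.sqrt (1 - β)) ^ 2

/-- `Δ*(r, β, σ) = ⌈ρ*(β, σ) / r⌉`. -/
def deltaStar (r β σ : ℝ) : ℕ := ⌈rhoStar β σ / r⌉₊

/-- The sparsity calibration `p = N^{-β}`. -/
def sparsity (β : ℝ) (N : ℕ) : ℝ := (N : ℝ) ^ (-β)

/-- The mean-shift calibration `μ = √(2 r log N)`. -/
def meanShift (r : ℝ) (N : ℕ) : ℝ := Real.sqrt (2 * r * Real.log N)

end SparseChange

end

open SparseChange

/-! The tests enter only through the fact that the event `T_U ≤ t` is determined by the observations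
up to time `t`. It therefore suffices that the joint laws of these observations under the two
hypotheses merge uniformly over events.

Randomizing the affected set makes the alternative an `N`-fold product of mixtures `(1 - p) Q + p f
Q` (`pi_mixture`), with `f` the likelihood ratio of one stream. The second moment of `f` may be
infinite or too large, so `p f` is discarded where it exceeds `1`. For any `s ∈ [1, 2]`, the single
quantity `K = p ^ s E f ^ s` bounds both the lost mass and the excess of the second moment over `1`.
Cauchy–Schwarz on the product then shows that `N K → 0` is enough (`abs_pi_mixture_sub_le`).

For Gaussian data with `m` post-change observations, `E f ^ s` is the `m`-th power of an explicit
one-observation moment (`exists_gaussianRatio_moment`). Since `μ² / 2 = r log N`, `N K` is a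
constant to the power `m` times `N` to the exponent `1 - β s + r m s (s - 1) / (s - σ² (s - 1))`.
When `r m < ρ*`, some `s` makes this exponent negative (`exists_moment_order`). As `m < Δ*` stays
bounded, the constants are harmless. -/

namespace SparseChange

/-! ### Products of densities and of mixtures -/

/-- A finite product of measures with real densities has the product density. -/
theorem pi_withDensity_ofReal {ι : Type*} [Fintype ι] {Ω : ι → Type*} [∀ i, MeasurableSpace (Ω i)]
    (Q : ∀ i, Measure (Ω i)) [∀ i, IsProbabilityMeasure (Q i)] (f : ∀ i, Ω i → ℝ)
    (hf0 : ∀ i x, 0 ≤ f i x) (hfi : ∀ i, Integrable (f i) (Q i)) :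
    Measure.pi (fun i => (Q i).withDensity (fun x => ENNReal.ofReal (f i x)))
      = (Measure.pi Q).withDensity (fun x => ENNReal.ofReal (∏ i, f i (x i))) := by
  have hfin : ∀ i, IsFiniteMeasure ((Q i).withDensity (fun x => ENNReal.ofReal (f i x))) :=
    fun i => isFiniteMeasure_withDensity_ofReal (hfi i).2
  refine Measure.pi_eq fun A hA => ?_
  rw [withDensity_apply _ (MeasurableSet.univ_pi hA), Measure.restrict_pi_pi,
    ← ofReal_integral_eq_lintegral_ofReal
      (Integrable.fintype_prod_dep fun i => (hfi i).restrict)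
      (Eventually.of_forall fun x => Finset.prod_nonneg fun i _ => hf0 i _),
    integral_fintype_prod_eq_prod,
    ENNReal.ofReal_prod_of_nonneg fun i _ => integral_nonneg (hf0 i)]
  refine Finset.prod_congr rfl fun i _ => ?_
  rw [withDensity_apply _ (hA i), ← ofReal_integral_eq_lintegral_ofReal (hfi i).restrict
    (Eventually.of_forall (hf0 i))]

/-- The law of independent draws from a two-component mixture is the mixture, over the random set
of coordinates that use the second component, of the product laws. -/
theorem pi_mixture {Ω : Type*} [MeasurableSpace Ω] (Q₀ Q₁ : Measure Ω) [IsProbabilityMeasure Q₀]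
    [IsProbabilityMeasure Q₁] {p : ℝ} (hp0 : 0 ≤ p) (hp1 : p ≤ 1) (N : ℕ) :
    Measure.pi (fun _ : Fin N => ENNReal.ofReal (1 - p) • Q₀ + ENNReal.ofReal p • Q₁)
      = ∑ I : Finset (Fin N), ENNReal.ofReal (p ^ I.card * (1 - p) ^ (N - I.card)) •
          Measure.pi (fun n => if n ∈ I then Q₁ else Q₀) := by
  have h0 : IsFiniteMeasure (ENNReal.ofReal (1 - p) • Q₀) :=
    Measure.smul_finite _ ENNReal.ofReal_ne_top
  have h1 : IsFiniteMeasure (ENNReal.ofReal p • Q₁) := Measure.smul_finite _ ENNReal.ofReal_ne_top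
  refine Measure.pi_eq fun A hA => ?_
  have hs (I : Finset (Fin N)) (n : Fin N) : SigmaFinite (if n ∈ I then Q₁ else Q₀) := by
    split_ifs <;> infer_instance
  simp only [Measure.coe_finsetSum, Finset.sum_apply, Measure.smul_apply, Measure.add_apply,
    smul_eq_mul, Measure.pi_pi]
  -- The affected component goes first so that the subset in `Finset.prod_add` is the affected set.
  simp_rw [add_comm (ENNReal.ofReal (1 - p) * _)]
  rw [Finset.prod_add, Finset.powerset_univ]
  refine Finset.sum_congr rfl fun I _ => ?_
  rw [Finset.prod_mul_distrib, Finset.prod_mul_distrib, Finset.prod_const, Finset.prod_const,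
    ENNReal.ofReal_mul (by positivity), ENNReal.ofReal_pow hp0, ENNReal.ofReal_pow (by linarith),
    ← Finset.prod_mul_prod_compl I, Finset.card_sdiff_of_subset (Finset.subset_univ _),
    Finset.card_univ, Fintype.card_fin, ← Finset.compl_eq_univ_sdiff]
  have e1 : ∏ n ∈ I, (if n ∈ I then Q₁ else Q₀) (A n) = ∏ n ∈ I, Q₁ (A n) :=
    Finset.prod_congr rfl fun n hn => by rw [if_pos hn]
  have e2 : ∏ n ∈ Iᶜ, (if n ∈ I then Q₁ else Q₀) (A n) = ∏ n ∈ Iᶜ, Q₀ (A n) :=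
    Finset.prod_congr rfl fun n hn => by rw [if_neg (Finset.mem_compl.1 hn)]
  rw [e1, e2]
  ring

/-! ### Truncated second moment method -/

/-- `E|1 - L| ≤ √(E L² - 2 E L + 1)` for a bounded function on a probability space. -/
theorem integral_abs_one_sub_le {Ω : Type*} [MeasurableSpace Ω] (P : Measure Ω)
    [IsProbabilityMeasure P] {L : Ω → ℝ} (hL : MemLp L 2 P) :
    ∫ x, |1 - L x| ∂P ≤ Real.sqrt (∫ x, L x ^ 2 ∂P - 2 * ∫ x, L x ∂P + 1) := by
  have hX : MemLp (fun x => |1 - L x|) 2 P := ((memLp_const (1 : ℝ)).sub hL).abs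
  -- Cauchy–Schwarz, in the form of a nonnegative variance.
  have hv := variance_nonneg (fun x => |1 - L x|) P
  rw [variance_eq_sub hX] at hv
  have hLi : Integrable L P := hL.integrable one_le_two
  have e : ∫ x, ((fun x => |1 - L x|) ^ 2) x ∂P = ∫ x, L x ^ 2 ∂P - 2 * ∫ x, L x ∂P + 1 := by
    have : ∀ x, ((fun x => |1 - L x|) ^ 2) x = L x ^ 2 - 2 * L x + 1 := fun x => by
      simp only [Pi.pow_apply, sq_abs]; ring
    simp_rw [this]
    have hi : Integrable (fun x => L x ^ 2 - 2 * L x) P :=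
      hL.integrable_sq.sub (hLi.const_mul 2)
    rw [integral_add hi (integrable_const _), integral_sub hL.integrable_sq (hLi.const_mul 2),
      integral_const_mul]
    simp
  rw [e] at hv
  exact Real.le_sqrt_of_sq_le (by linarith)

/-- If `P₁` dominates a bounded density `L` with respect to `P₀`, then `P₁` and `P₀` are close on
every event as soon as `L` is close to `1` in mean square. -/
theorem abs_measureReal_sub_le {Ω : Type*} [MeasurableSpace Ω] (P₀ P₁ : Measure Ω)
    [IsProbabilityMeasure P₀] [IsProbabilityMeasure P₁] {L : Ω → ℝ} (hL : MemLp L 2 P₀)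
    (hle : ∀ A, MeasurableSet A → ∫ x in A, L x ∂P₀ ≤ P₁.real A)
    {A : Set Ω} (hA : MeasurableSet A) :
    |P₁.real A - P₀.real A| ≤ Real.sqrt (∫ x, L x ^ 2 ∂P₀ - 2 * ∫ x, L x ∂P₀ + 1) := by
  have hLi : Integrable L P₀ := hL.integrable one_le_two
  have hint : Integrable (fun x => 1 - L x) P₀ := (integrable_const _).sub hLi
  have key : ∀ B, MeasurableSet B → P₀.real B - P₁.real B ≤
      Real.sqrt (∫ x, L x ^ 2 ∂P₀ - 2 * ∫ x, L x ∂P₀ + 1) := fun B hB => by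
    have h1 : ∫ x in B, (1 - L x) ∂P₀ = P₀.real B - ∫ x in B, L x ∂P₀ := by
      rw [integral_sub (integrable_const _) hLi.restrict]; simp
    have h2 : ∫ x in B, (1 - L x) ∂P₀ ≤ ∫ x in B, |1 - L x| ∂P₀ :=
      integral_mono hint.restrict hint.abs.restrict fun x => le_abs_self _
    have h3 : ∫ x in B, |1 - L x| ∂P₀ ≤ ∫ x, |1 - L x| ∂P₀ :=
      setIntegral_le_integral hint.abs (Eventually.of_forall fun x => abs_nonneg _)
    linarith [hle B hB, integral_abs_one_sub_le P₀ hL]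
  -- Domination is one-sided, so the other direction comes from the complement.
  have hc := key Aᶜ hA.compl
  rw [probReal_compl_eq_one_sub hA, probReal_compl_eq_one_sub hA] at hc
  exact abs_le.2 ⟨by linarith [key A hA], by linarith⟩

/-- Truncated second moment bound for sparse mixtures: with `K = p ^ s E₀ f ^ s` for some
`1 ≤ s ≤ 2`, the `N`-fold products of `Q₀` and of `(1 - p) Q₀ + p f Q₀` differ by at most
`√(exp (N K) - 1 + 2 N K)` on every event. -/
theorem abs_pi_mixture_sub_le {Ω : Type*} [MeasurableSpace Ω] (Q : Measure Ω)
    [IsProbabilityMeasure Q] {f : Ω → ℝ} (hfm : Measurable f) (hf0 : ∀ x, 0 ≤ f x)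
    (hfi : Integrable f Q) (hf1 : ∫ x, f x ∂Q = 1) {p s : ℝ} (hp0 : 0 ≤ p) (hp1 : p ≤ 1)
    (hs1 : 1 ≤ s) (hs2 : s ≤ 2) (hfs : Integrable (fun x => f x ^ s) Q) (N : ℕ)
    {A : Set (Fin N → Ω)} (hA : MeasurableSet A) :
    |(Measure.pi (fun _ : Fin N => ENNReal.ofReal (1 - p) • Q + ENNReal.ofReal p •
        Q.withDensity (fun x => ENNReal.ofReal (f x)))).real A
      - (Measure.pi (fun _ : Fin N => Q)).real A|
    ≤ Real.sqrt (Real.exp (N * (p ^ s * ∫ x, f x ^ s ∂Q)) - 1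
        + 2 * (N * (p ^ s * ∫ x, f x ^ s ∂Q))) := by
  set K := p ^ s * ∫ x, f x ^ s ∂Q with hK
  have hq : 0 ≤ 1 - p := by linarith
  have hmix : ENNReal.ofReal (1 - p) • Q + ENNReal.ofReal p •
      Q.withDensity (fun x => ENNReal.ofReal (f x))
      = Q.withDensity (fun x => ENNReal.ofReal (1 - p + p * f x)) := by
    have : (fun x => ENNReal.ofReal (1 - p + p * f x))
        = (fun _ => ENNReal.ofReal (1 - p)) +
          (ENNReal.ofReal p • fun x => ENNReal.ofReal (f x)) := by
      funext x
      simp only [Pi.add_apply, Pi.smul_apply, smul_eq_mul]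
      rw [ENNReal.ofReal_add hq (mul_nonneg hp0 (hf0 x)), ENNReal.ofReal_mul hp0]
    rw [this, withDensity_add_left measurable_const, withDensity_const,
      withDensity_smul _ hfm.ennreal_ofReal]
  have hgi : Integrable (fun x => 1 - p + p * f x) Q :=
    (integrable_const _).add (hfi.const_mul p)
  have hg0 : ∀ x, 0 ≤ 1 - p + p * f x := fun x => add_nonneg hq (mul_nonneg hp0 (hf0 x))
  have hprob : IsProbabilityMeasure
      (Q.withDensity (fun x => ENNReal.ofReal (1 - p + p * f x))) := by
    constructor
    rw [withDensity_apply _ MeasurableSet.univ, setLIntegral_univ,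
      ← ofReal_integral_eq_lintegral_ofReal hgi (Eventually.of_forall hg0),
      integral_add (integrable_const _) (hfi.const_mul p), integral_const_mul, hf1]
    simp
  rw [hmix]
  -- the truncated density
  set S : Set Ω := {x | p * f x ≤ 1}
  have hSm : MeasurableSet S := measurableSet_le (hfm.const_mul p) measurable_const
  -- Not a probability density: the mass of `p f` outside `S` is lost. In exchange `h ≤ 2`, so
  -- square integrability needs no second moment of `f`.
  set h : Ω → ℝ := fun x => 1 - p + S.indicator (fun x => p * f x) x with hh
  have hind : ∀ x, 0 ≤ S.indicator (fun x => p * f x) x ∧ S.indicator (fun x => p * f x) x ≤ 1 ∧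
      S.indicator (fun x => p * f x) x ≤ p * f x := fun x => by
    by_cases hx : x ∈ S
    · simp only [Set.indicator_of_mem hx]
      exact ⟨mul_nonneg hp0 (hf0 x), hx, le_rfl⟩
    · simp only [Set.indicator_of_notMem hx]
      exact ⟨le_rfl, zero_le_one, mul_nonneg hp0 (hf0 x)⟩
  have hhm : Measurable h := ((hfm.const_mul p).indicator hSm).const_add _
  have hh0 : ∀ x, 0 ≤ h x := fun x => add_nonneg hq (hind x).1
  have hh2 : ∀ x, h x ≤ 2 := fun x => by have := (hind x).2.1; simp only [hh]; linarith
  have hhg : ∀ x, h x ≤ 1 - p + p * f x := fun x => by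
    have := (hind x).2.2; simp only [hh]; linarith
  have hhL : MemLp h 2 Q := MemLp.of_bound hhm.aestronglyMeasurable 2
    (Eventually.of_forall fun x => by rw [Real.norm_of_nonneg (hh0 x)]; exact hh2 x)
  have hhi : Integrable h Q := hhL.integrable one_le_two
  have hpow : ∀ x, (p * f x) ^ s = p ^ s * f x ^ s := fun x => Real.mul_rpow hp0 (hf0 x)
  have hKi : Integrable (fun x => p ^ s * f x ^ s) Q := hfs.const_mul _
  have hKint : ∫ x, p ^ s * f x ^ s ∂Q = K := integral_const_mul _ _
  have hpfi : Integrable (fun x => p * f x) Q := hfi.const_mul p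
  -- first moment
  have hm1 : 1 - K ≤ ∫ x, h x ∂Q := by
    have e : 1 - K = ∫ x, (1 - p + p * f x - p ^ s * f x ^ s) ∂Q := by
      rw [integral_sub hgi hKi, hKint, integral_add (integrable_const _) hpfi,
        integral_const_mul, hf1]
      simp
    rw [e]
    refine integral_mono (hgi.sub hKi) hhi fun x => ?_
    simp only [hh]
    by_cases hx : x ∈ S
    · rw [Set.indicator_of_mem hx]
      have := mul_nonneg (Real.rpow_nonneg hp0 s) (Real.rpow_nonneg (hf0 x) s)
      linarith
    · rw [Set.indicator_of_notMem hx, ← hpow]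
      -- Off `S` the lost mass satisfies `p f ≤ (p f) ^ s`, because `s ≥ 1`.
      have hx' : 1 < p * f x := not_le.1 hx
      have := Real.rpow_le_rpow_of_exponent_le hx'.le hs1
      rw [Real.rpow_one] at this
      linarith
  have hm1' : 0 ≤ ∫ x, h x ∂Q := integral_nonneg hh0
  -- second moment
  have hm2 : ∫ x, h x ^ 2 ∂Q ≤ 1 + K := by
    have hi : Integrable (fun x => (1 - p) ^ 2 + 2 * (1 - p) * (p * f x)) Q :=
      (integrable_const _).add (hpfi.const_mul _)
    have hi' : Integrable (fun x => (1 - p) ^ 2 + 2 * (1 - p) * (p * f x) + p ^ s * f x ^ s) Q :=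
      hi.add hKi
    calc ∫ x, h x ^ 2 ∂Q
        ≤ ∫ x, ((1 - p) ^ 2 + 2 * (1 - p) * (p * f x) + p ^ s * f x ^ s) ∂Q := by
          refine integral_mono hhL.integrable_sq hi' fun x => ?_
          have hc := hind x
          have : S.indicator (fun x => p * f x) x ^ 2 ≤ p ^ s * f x ^ s := by
            by_cases hx : x ∈ S
            · rw [Set.indicator_of_mem hx, ← hpow, ← Real.rpow_two]
              -- On `S`, `(p f) ^ 2 ≤ (p f) ^ s` because `p f ≤ 1` and `s ≤ 2`; base `0` is treated
              -- apart.
              rcases (mul_nonneg hp0 (hf0 x)).eq_or_lt with h0 | h0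
              · rw [← h0, Real.zero_rpow two_ne_zero, Real.zero_rpow (by linarith)]
              · exact Real.rpow_le_rpow_of_exponent_ge h0 hx hs2
            · rw [Set.indicator_of_notMem hx, zero_pow two_ne_zero]
              exact mul_nonneg (Real.rpow_nonneg hp0 s) (Real.rpow_nonneg (hf0 x) s)
          simp only [hh]
          nlinarith [mul_le_mul_of_nonneg_left hc.2.2 hq]
      _ = (1 - p) ^ 2 + 2 * (1 - p) * p + K := by
          rw [integral_add hi hKi, integral_add (integrable_const _) (hpfi.const_mul _), hKint,
            integral_const_mul, integral_const_mul, hf1]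
          simp
      _ ≤ 1 + K := by nlinarith [sq_nonneg p]
  -- the product
  set L : (Fin N → Ω) → ℝ := fun x => ∏ n, h (x n) with hLdef
  have hL0 : ∀ x, 0 ≤ L x := fun x => Finset.prod_nonneg fun n _ => hh0 _
  have hLm : Measurable L := Finset.measurable_prod _ fun n _ => hhm.comp (measurable_pi_apply n)
  have hL : MemLp L 2 (Measure.pi (fun _ : Fin N => Q)) :=
    MemLp.of_bound hLm.aestronglyMeasurable (2 ^ N) (Eventually.of_forall fun x => by
      rw [Real.norm_of_nonneg (hL0 x)]
      exact (Finset.prod_le_prod (fun n _ => hh0 _) fun n _ => hh2 _).trans (by simp))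
  have hEL : ∫ x, L x ∂(Measure.pi (fun _ : Fin N => Q)) = (∫ x, h x ∂Q) ^ N := by
    simp only [hLdef]; rw [integral_fintype_prod_eq_pow, Fintype.card_fin]
  have hEL2 : ∫ x, L x ^ 2 ∂(Measure.pi (fun _ : Fin N => Q)) = (∫ x, h x ^ 2 ∂Q) ^ N := by
    simp only [hLdef, ← Finset.prod_pow]
    rw [integral_fintype_prod_eq_pow (f := fun x => h x ^ 2), Fintype.card_fin]
  -- Bernoulli's inequality.
  have hb1 : 1 - N * K ≤ (∫ x, h x ∂Q) ^ N := by
    have := one_add_mul_le_pow (a := ∫ x, h x ∂Q - 1) (by linarith) N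
    rw [add_sub_cancel] at this
    have h2 : (N : ℝ) * (1 - K - 1) ≤ N * (∫ x, h x ∂Q - 1) := by gcongr
    linarith
  have hb2 : (∫ x, h x ^ 2 ∂Q) ^ N ≤ Real.exp (N * K) := by
    rw [Real.exp_nat_mul]
    exact pow_le_pow_left₀ (integral_nonneg fun x => sq_nonneg _)
      (hm2.trans (by linarith [Real.add_one_le_exp K])) N
  refine (abs_measureReal_sub_le _ _ hL (fun B hB => ?_) hA).trans
    (Real.sqrt_le_sqrt (by rw [hEL, hEL2]; linarith))
  rw [pi_withDensity_ofReal (fun _ : Fin N => Q) (fun _ x => 1 - p + p * f x) (fun _ => hg0)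
    (fun _ => hgi)]
  have hGi : Integrable (fun x : Fin N → Ω => ∏ n, (1 - p + p * f (x n)))
      (Measure.pi (fun _ : Fin N => Q)) := Integrable.fintype_prod fun _ => hgi
  have hG0 : ∀ x : Fin N → Ω, 0 ≤ ∏ n, (1 - p + p * f (x n)) :=
    fun x => Finset.prod_nonneg fun n _ => hg0 _
  rw [measureReal_def, withDensity_apply _ hB, ← ofReal_integral_eq_lintegral_ofReal
    hGi.restrict (Eventually.of_forall hG0), ENNReal.toReal_ofReal (integral_nonneg hG0)]
  exact integral_mono (hL.integrable one_le_two).restrict hGi.restrict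
    fun x => Finset.prod_le_prod (fun n _ => hh0 _) fun n _ => hhg _

/-! ### Moments of the Gaussian likelihood ratio -/

/-- The likelihood ratio of `N(μ, v)` to `N(0, 1)`. -/
noncomputable def gaussianRatio (μ : ℝ) (v : NNReal) (x : ℝ) : ℝ :=
  gaussianPDFReal μ v x / gaussianPDFReal 0 1 x

theorem gaussianRatio_nonneg (μ : ℝ) (v : NNReal) (x : ℝ) : 0 ≤ gaussianRatio μ v x :=
  div_nonneg (gaussianPDFReal_nonneg _ _ _) (gaussianPDFReal_nonneg _ _ _)

theorem measurable_gaussianRatio (μ : ℝ) (v : NNReal) : Measurable (gaussianRatio μ v) :=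
  (measurable_gaussianPDFReal μ v).div (measurable_gaussianPDFReal 0 1)

theorem gaussianReal_eq_withDensity_gaussianRatio (μ : ℝ) {v : NNReal} (hv : v ≠ 0) :
    gaussianReal μ v
      = (gaussianReal 0 1).withDensity (fun x => ENNReal.ofReal (gaussianRatio μ v x)) := by
  rw [gaussianReal_of_var_ne_zero μ hv, gaussianReal_of_var_ne_zero 0 one_ne_zero,
    ← withDensity_mul _ (measurable_gaussianPDF 0 1)
      (measurable_gaussianRatio μ v).ennreal_ofReal]
  congr 1
  funext x
  have h := gaussianPDFReal_pos 0 1 x one_ne_zero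
  rw [Pi.mul_apply, gaussianPDF, gaussianPDF, ← ENNReal.ofReal_mul h.le, gaussianRatio,
    mul_div_cancel₀ _ h.ne']

theorem gaussianRatio_eq (μ : ℝ) {v : NNReal} (hv : v ≠ 0) (x : ℝ) :
    gaussianRatio μ v x = (Real.sqrt v)⁻¹ * Real.exp (x ^ 2 / 2 - (x - μ) ^ 2 / (2 * v)) := by
  have hπ : Real.sqrt (2 * Real.pi) ≠ 0 := by positivity
  rw [gaussianRatio, gaussianPDFReal, gaussianPDFReal, Real.exp_sub,
    Real.sqrt_mul (by positivity) (v : ℝ)]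
  simp only [NNReal.coe_one, mul_one, sub_zero, neg_div, Real.exp_neg]
  field_simp

/-- Completing the square: the integrand is a Gaussian centred at `s μ / D` with precision `D / v`,
where `D = s - v (s - 1)`; the remainder is the exponential in `μ²`. -/
theorem integral_gaussianRatio_rpow {v : NNReal} (hv : v ≠ 0) {s : ℝ}
    (hs : 0 < s - v * (s - 1)) (μ : ℝ) :
    ∫ x, gaussianRatio μ v x ^ s ∂(gaussianReal 0 1)
      = (Real.sqrt v)⁻¹ ^ s * (Real.sqrt (2 * Real.pi))⁻¹ *
          Real.sqrt (Real.pi / ((s - v * (s - 1)) / v / 2))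
        * Real.exp (μ ^ 2 / 2 * (s * (s - 1) / (s - v * (s - 1)))) := by
  have hv' : (v : ℝ) ≠ 0 := by exact_mod_cast hv
  set D := s - v * (s - 1) with hD
  rw [integral_gaussianReal_eq_integral_smul one_ne_zero]
  have key : ∀ x, gaussianPDFReal 0 1 x • gaussianRatio μ v x ^ s
      = ((Real.sqrt v)⁻¹ ^ s * (Real.sqrt (2 * Real.pi))⁻¹ *
        Real.exp (μ ^ 2 / 2 * (s * (s - 1) / D))) *
        Real.exp (-(D / v / 2) * (x - s * μ / D) ^ 2) := fun x => by
    rw [gaussianRatio_eq μ hv, Real.mul_rpow (by positivity) (Real.exp_pos _).le,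
      ← Real.exp_mul, gaussianPDFReal, smul_eq_mul]
    simp only [NNReal.coe_one, mul_one, sub_zero]
    have e : Real.exp (-x ^ 2 / 2) * Real.exp ((x ^ 2 / 2 - (x - μ) ^ 2 / (2 * v)) * s)
        = Real.exp (μ ^ 2 / 2 * (s * (s - 1) / D)) *
          Real.exp (-(D / v / 2) * (x - s * μ / D) ^ 2) := by
      rw [← Real.exp_add, ← Real.exp_add]
      congr 1
      field_simp
      rw [hD]
      ring
    linear_combination ((Real.sqrt v)⁻¹ ^ s * (Real.sqrt (2 * Real.pi))⁻¹) * e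
  simp_rw [key]
  rw [integral_const_mul,
    integral_sub_right_eq_self (fun x => Real.exp (-(D / v / 2) * x ^ 2)) (s * μ / D),
    integral_gaussian]
  ring

/-- Moments of the Gaussian likelihood ratio: they exist for `s - v (s - 1) > 0` and grow with the
mean shift `μ` like `exp (μ² / 2 · s (s - 1) / (s - v (s - 1)))`. -/
theorem exists_gaussianRatio_moment {v : NNReal} (hv : v ≠ 0) {s : ℝ}
    (hs : 0 < s - v * (s - 1)) :
    ∃ C : ℝ, ∀ μ : ℝ,
      Integrable (fun x => gaussianRatio μ v x ^ s) (gaussianReal 0 1) ∧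
      ∫ x, gaussianRatio μ v x ^ s ∂(gaussianReal 0 1)
        = C * Real.exp (μ ^ 2 / 2 * (s * (s - 1) / (s - v * (s - 1)))) := by
  refine ⟨_, fun μ => ⟨?_, integral_gaussianRatio_rpow hv hs μ⟩⟩
  -- A nonintegrable function has Bochner integral `0`, whereas the value here is positive.
  refine not_imp_comm.1 integral_undef ?_
  rw [integral_gaussianRatio_rpow hv hs μ]
  have hv' : 0 < (v : ℝ) := by positivity
  positivity

theorem integral_gaussianRatio (μ : ℝ) {v : NNReal} (hv : v ≠ 0) :
    Integrable (gaussianRatio μ v) (gaussianReal 0 1) ∧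
      ∫ x, gaussianRatio μ v x ∂(gaussianReal 0 1) = 1 := by
  have h : ∫ x, gaussianRatio μ v x ∂(gaussianReal 0 1) = 1 := by
    rw [integral_gaussianReal_eq_integral_smul one_ne_zero,
      ← integral_gaussianPDFReal_eq_one μ hv]
    refine integral_congr_ae (Eventually.of_forall fun x => ?_)
    exact mul_div_cancel₀ _ (gaussianPDFReal_pos 0 1 x one_ne_zero).ne'
  exact ⟨not_imp_comm.1 integral_undef (by rw [h]; exact one_ne_zero), h⟩

/-! ### The detection boundary -/

/-- Below the detection boundary some moment of order `s ∈ [1, 2]` of the likelihood ratio beats the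
sparsity. -/
theorem exists_moment_order {β σ R : ℝ} (hβ' : β < 1) (hσ : 0 < σ) (hR0 : 0 ≤ R)
    (hR : R < rhoStar β σ) :
    ∃ s, 1 ≤ s ∧ s ≤ 2 ∧ 0 < s - σ ^ 2 * (s - 1) ∧
      1 - β * s + R * (s * (s - 1) / (s - σ ^ 2 * (s - 1))) < 0 := by
  -- With `q = √(1 - β)`, the order is `s = σ / (σ - q)`, at which the exponent vanishes exactly for
  -- `R = (1 - σ q) ^ 2`. The condition `2 q ≤ σ` gives `s ≤ 2`, and `σ q < 1` makes the moment
  -- finite.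
  have dense : 2 * Real.sqrt (1 - β) ≤ σ → σ * Real.sqrt (1 - β) ≤ 1 →
      R < (1 - σ * Real.sqrt (1 - β)) ^ 2 →
      ∃ s, 1 ≤ s ∧ s ≤ 2 ∧ 0 < s - σ ^ 2 * (s - 1) ∧
        1 - β * s + R * (s * (s - 1) / (s - σ ^ 2 * (s - 1))) < 0 := by
    intro h1 h2 h3
    have hq : 0 < Real.sqrt (1 - β) := Real.sqrt_pos.2 (by linarith)
    have hq2 : Real.sqrt (1 - β) ^ 2 = 1 - β := Real.sq_sqrt (by linarith)
    set q := Real.sqrt (1 - β)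
    have hβq : β = 1 - q ^ 2 := by linarith
    have hx : 0 < 1 - σ * q := by
      rcases h2.lt_or_eq with h | h
      · linarith
      -- Equality `σ q = 1` would force `R < 0`.
      · rw [h] at h3; norm_num at h3; linarith
    have hd : 0 < σ - q := by linarith
    have hs1 : σ / (σ - q) - 1 = q / (σ - q) := by field_simp; ring
    have hD : σ / (σ - q) - σ ^ 2 * (σ / (σ - q) - 1) = σ * (1 - σ * q) / (σ - q) := by
      rw [hs1]; field_simp
    refine ⟨σ / (σ - q), ?_, ?_, ?_, ?_⟩
    · rw [le_div_iff₀ hd]; linarith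
    · rw [div_le_iff₀ hd]; linarith
    · rw [hD]; positivity
    · rw [hD, hs1]
      have e : 1 - β * (σ / (σ - q)) + R * (σ / (σ - q) * (q / (σ - q)) /
          (σ * (1 - σ * q) / (σ - q)))
          = q * (R - (1 - σ * q) ^ 2) / ((σ - q) * (1 - σ * q)) := by
        have hx' := hx.ne'
        have hd' := hd.ne'
        have e1 : 1 - β * (σ / (σ - q)) = -(q * (1 - σ * q)) / (σ - q) := by
          rw [hβq, eq_div_iff hd', sub_mul, mul_assoc, div_mul_cancel₀ _ hd']
          ring
        have e2 : σ / (σ - q) * (q / (σ - q)) / (σ * (1 - σ * q) / (σ - q))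
            = q / ((σ - q) * (1 - σ * q)) := by
          generalize 1 - σ * q = d at hx' ⊢
          field_simp
        rw [e1, e2]
        generalize 1 - σ * q = d at hx' ⊢
        field_simp
        ring
      rw [e]
      exact div_neg_of_neg_of_pos (mul_neg_of_pos_of_neg hq (by linarith)) (by positivity)
  unfold rhoStar at hR
  split_ifs at hR with c1 c2 c3
  -- Here the ordinary second moment suffices.
  · refine ⟨2, by norm_num, le_rfl, by linarith, ?_⟩
    have hd : 0 < 2 - σ ^ 2 := by linarith
    have e : 1 - β * 2 + R * (2 * (2 - 1) / (2 - σ ^ 2 * (2 - 1)))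
        = 2 * (R - (2 - σ ^ 2) * (β - 1 / 2)) / (2 - σ ^ 2) := by
      norm_num only [mul_one]; field_simp; ring
    rw [e]
    exact div_neg_of_neg_of_pos (by linarith) hd
  · have h1 : Real.sqrt (1 - β) ≤ σ / 2 := Real.sqrt_le_iff.2 ⟨by linarith, by nlinarith⟩
    exact dense (by linarith) (by nlinarith) hR
  · linarith
  · have h1 : Real.sqrt (1 - β) ≤ 1 / σ :=
      Real.sqrt_le_iff.2 ⟨by positivity, by rw [div_pow, one_pow]; linarith⟩
    have h2 : σ * Real.sqrt (1 - β) ≤ 1 := by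
      rw [le_div_iff₀ hσ] at h1; linarith
    refine dense ?_ h2 hR
    have := Real.sqrt_nonneg (1 - β)
    nlinarith

/-! ### The stopping event: measurability and dependence on the past -/

/-- The events of the stopping time in elementary terms. -/
theorem stopTime_le_iff {N : ℕ} (kind : TestKind) (μ : ℝ) (w : ℕ+) (H : ℕ)
    (U : ℕ → (Fin N → ℝ) → ℝ) (b : ℕ → ℝ) (X : Fin N → ℕ → ℝ) (t : ℕ) :
    stopTime kind μ w H U b X ≤ (t : ℕ∞) ↔
      ∃ s, s ≤ t ∧ 1 ≤ s ∧ s ≤ H ∧ b s < U s (pValues kind μ w s X) := by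
  constructor
  · intro h
    have hne : ((fun s : ℕ => (s : ℕ∞)) ''
        {s : ℕ | 1 ≤ s ∧ s ≤ H ∧ b s < U s (pValues kind μ w s X)}).Nonempty := by
      rw [Set.nonempty_iff_ne_empty]
      intro h0
      rw [stopTime, h0, sInf_empty, top_le_iff] at h
      exact ENat.natCast_ne_top t h
    obtain ⟨s, hs, he⟩ := csInf_mem hne
    refine ⟨s, ?_, hs⟩
    have : (s : ℕ∞) ≤ t := he.trans_le h
    exact_mod_cast this
  · rintro ⟨s, hst, hs⟩
    have h1 : stopTime kind μ w H U b X ≤ (s : ℕ∞) := sInf_le (Set.mem_image_of_mem _ hs)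
    exact h1.trans (Nat.cast_le.2 hst)

theorem partialSum_congr {x y : ℕ → ℝ} {k : ℕ} (h : ∀ j ≤ k, x j = y j) :
    partialSum x k = partialSum y k :=
  Finset.sum_congr rfl fun j hj => h j (Finset.mem_Icc.1 hj).2

/-- The statistic of time `t` depends only on the observations up to time `t`. -/
theorem streamStat_congr (kind : TestKind) (μ : ℝ) (w : ℕ+) {t : ℕ} {x y : ℕ → ℝ}
    (h : ∀ j ≤ t, x j = y j) : streamStat kind μ w t x = streamStat kind μ w t y := by
  have hk : ∀ k ≤ t, partialSum x k = partialSum y k :=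
    fun k hk => partialSum_congr fun j hj => h j (hj.trans hk)
  cases kind
  · refine Finset.sup'_congr (Finset.nonempty_Icc.2 t.zero_le) rfl fun k hk' => ?_
    rw [hk k (Finset.mem_Icc.1 hk').2, hk t le_rfl]
  · refine Finset.sup'_congr (Finset.nonempty_Icc.2 (by have := w.pos; omega)) rfl
      fun k hk' => ?_
    rw [hk k (Finset.mem_Icc.1 hk').2, hk t le_rfl]

theorem measurable_partialSum (t : ℕ) : Measurable fun x : ℕ → ℝ => partialSum x t :=
  Finset.measurable_sum _ fun j _ => measurable_pi_apply j

theorem measurable_streamStat (kind : TestKind) (μ : ℝ) (w : ℕ+) (t : ℕ) :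
    Measurable (streamStat kind μ w t) := by
  have hm := measurable_partialSum
  cases kind
  · have hne : (Finset.Icc 0 t).Nonempty := Finset.nonempty_Icc.2 t.zero_le
    let F : ℕ → (ℕ → ℝ) → ℝ := fun k x =>
      (partialSum x t - partialSum x k - μ / 2 * ((t : ℝ) - k)) * μ
    have : streamStat TestKind.LR μ w t = (Finset.Icc 0 t).sup' hne F :=
      funext fun x => (Finset.sup'_apply hne F x).symm
    rw [this]
    exact Finset.measurable_sup' _ fun k _ =>
      (((hm t).sub (hm k)).sub_const _).mul_const _
  · have hne : (Finset.Icc (t + 1 - (w : ℕ)) t).Nonempty :=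
      Finset.nonempty_Icc.2 (by have := w.pos; omega)
    let F : ℕ → (ℕ → ℝ) → ℝ := fun k x =>
      |partialSum x t - partialSum x k| / Real.sqrt ((t : ℝ) - k)
    have : streamStat TestKind.GLR μ w t = (Finset.Icc (t + 1 - (w : ℕ)) t).sup' hne F :=
      funext fun x => (Finset.sup'_apply hne F x).symm
    rw [this]
    exact Finset.measurable_sup' _ fun k _ => ((hm t).sub (hm k)).abs.div_const _

instance : IsProbabilityMeasure nullStream := by unfold nullStream; infer_instance

instance (μ σ : ℝ) (τ : ℕ) : IsProbabilityMeasure (changedStream μ σ τ) := by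
  unfold changedStream; infer_instance

theorem measurable_survival (kind : TestKind) (μ : ℝ) (w : ℕ+) (t : ℕ) :
    Measurable (survival kind μ w t) := by
  have : Antitone (survival kind μ w t) := fun a b hab =>
    measureReal_mono fun x (hx : b ≤ _) => hab.trans hx
  exact this.measurable

theorem measurable_pValues {N : ℕ} (kind : TestKind) (μ : ℝ) (w : ℕ+) (t : ℕ) :
    Measurable (pValues (N := N) kind μ w t) :=
  measurable_pi_lambda _ fun n => (measurable_survival kind μ w t).comp
    ((measurable_streamStat kind μ w t).comp (measurable_pi_apply n))

theorem measurableSet_stopTime_le {N : ℕ} (kind : TestKind) (μ : ℝ) (w : ℕ+) (H : ℕ)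
    {U : ℕ → (Fin N → ℝ) → ℝ} (hU : ∀ s, Measurable (U s)) (b : ℕ → ℝ) (t : ℕ) :
    MeasurableSet {X | stopTime kind μ w H U b X ≤ (t : ℕ∞)} := by
  have : {X | stopTime kind μ w H U b X ≤ (t : ℕ∞)} = ⋃ s : ℕ, ⋃ _ : s ≤ t ∧ 1 ≤ s ∧ s ≤ H,
      {X | b s < U s (pValues kind μ w s X)} := by
    ext X
    simp only [Set.mem_ofPred_eq, stopTime_le_iff, Set.mem_iUnion, exists_prop, and_assoc]
  rw [this]
  exact .iUnion fun s => .iUnion fun _ =>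
    measurableSet_lt measurable_const ((hU s).comp (measurable_pValues kind μ w s))

theorem stopTime_le_congr {N : ℕ} (kind : TestKind) (μ : ℝ) (w : ℕ+) (H : ℕ)
    (U : ℕ → (Fin N → ℝ) → ℝ) (b : ℕ → ℝ) {t : ℕ} {X Y : Fin N → ℕ → ℝ}
    (h : ∀ n, ∀ j ≤ t, X n j = Y n j) :
    stopTime kind μ w H U b X ≤ (t : ℕ∞) ↔ stopTime kind μ w H U b Y ≤ (t : ℕ∞) := by
  rw [stopTime_le_iff, stopTime_le_iff]
  refine exists_congr fun s => and_congr_right fun hs => ?_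
  have : pValues kind μ w s X = pValues kind μ w s Y := funext fun n => by
    rw [pValues, pValues, streamStat_congr kind μ w fun j hj => h n j (hj.trans hs)]
  rw [this]

/-! ### Likelihood ratio of one stream up to time `t` -/

theorem mk_sq_ne_zero {σ : ℝ} (hσ : 0 < σ) : (⟨σ ^ 2, sq_nonneg σ⟩ : NNReal) ≠ 0 := fun h =>
  (pow_pos hσ 2).ne' (congrArg NNReal.toReal h)

theorem map_restrict_nullStream (t : ℕ) :
    nullStream.map (Finset.Iic t).restrict
      = Measure.pi (fun _ : Finset.Iic t => gaussianReal 0 1) :=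
  Measure.infinitePi_map_restrict _

theorem map_restrict_changedStream_of_lt (μ σ : ℝ) {τ t : ℕ} (h : t < τ) :
    (changedStream μ σ τ).map (Finset.Iic t).restrict
      = Measure.pi (fun _ : Finset.Iic t => gaussianReal 0 1) := by
  rw [changedStream, Measure.infinitePi_map_restrict]
  congr 1
  funext j
  have : (j : ℕ) < τ := (Finset.mem_Iic.1 j.2).trans_lt h
  simp [this]

/-- The likelihood ratio, given the observations up to time `t`, of one changed stream. -/
noncomputable def streamRatio (μ σ : ℝ) (τ t : ℕ) (x : Finset.Iic t → ℝ) : ℝ :=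
  ∏ j : Finset.Iic t, if (j : ℕ) < τ then 1 else gaussianRatio μ ⟨σ ^ 2, sq_nonneg σ⟩ (x j)

theorem integrable_streamRatio_factor (μ : ℝ) {σ : ℝ} (hσ : 0 < σ) (τ j : ℕ) :
    Integrable (fun y => if j < τ then 1 else gaussianRatio μ ⟨σ ^ 2, sq_nonneg σ⟩ y)
      (gaussianReal 0 1) := by
  split_ifs
  · exact integrable_const _
  · exact (integral_gaussianRatio μ (mk_sq_ne_zero hσ)).1

theorem streamRatio_factor_nonneg (μ σ : ℝ) (τ j : ℕ) (y : ℝ) :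
    0 ≤ if j < τ then 1 else gaussianRatio μ ⟨σ ^ 2, sq_nonneg σ⟩ y := by
  split_ifs
  · exact zero_le_one
  · exact gaussianRatio_nonneg _ _ _

theorem streamRatio_nonneg (μ σ : ℝ) (τ t : ℕ) (x : Finset.Iic t → ℝ) :
    0 ≤ streamRatio μ σ τ t x :=
  Finset.prod_nonneg fun j _ => streamRatio_factor_nonneg μ σ τ j (x j)

theorem measurable_streamRatio (μ σ : ℝ) (τ t : ℕ) : Measurable (streamRatio μ σ τ t) := by
  refine Finset.measurable_prod _ fun j _ => ?_
  split_ifs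
  · exact measurable_const
  · exact (measurable_gaussianRatio _ _).comp (measurable_pi_apply j)

theorem map_restrict_changedStream (μ : ℝ) {σ : ℝ} (hσ : 0 < σ) (τ t : ℕ) :
    (changedStream μ σ τ).map (Finset.Iic t).restrict
      = (Measure.pi (fun _ : Finset.Iic t => gaussianReal 0 1)).withDensity
          (fun x => ENNReal.ofReal (streamRatio μ σ τ t x)) := by
  rw [changedStream, Measure.infinitePi_map_restrict]
  simp only [streamRatio]
  rw [← pi_withDensity_ofReal (fun _ : Finset.Iic t => gaussianReal 0 1)
    (fun j y => if (j : ℕ) < τ then 1 else gaussianRatio μ ⟨σ ^ 2, sq_nonneg σ⟩ y)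
    (fun j => streamRatio_factor_nonneg μ σ τ j)
    (fun j => integrable_streamRatio_factor μ hσ τ j)]
  congr 1
  funext j
  by_cases h : (j : ℕ) < τ
  · simp [h, ← Pi.one_def]
  · simp only [h, if_false]
    exact gaussianReal_eq_withDensity_gaussianRatio μ (mk_sq_ne_zero hσ)

theorem integral_streamRatio (μ : ℝ) {σ : ℝ} (hσ : 0 < σ) (τ t : ℕ) :
    Integrable (streamRatio μ σ τ t) (Measure.pi (fun _ : Finset.Iic t => gaussianReal 0 1)) ∧
    ∫ x, streamRatio μ σ τ t x ∂(Measure.pi (fun _ : Finset.Iic t => gaussianReal 0 1)) = 1 := by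
  refine ⟨Integrable.fintype_prod_dep (f := fun (j : Finset.Iic t) y => if (j : ℕ) < τ then 1 else
    gaussianRatio μ ⟨σ ^ 2, sq_nonneg σ⟩ y) fun j => integrable_streamRatio_factor μ hσ τ j, ?_⟩
  simp only [streamRatio]
  rw [integral_fintype_prod_eq_prod (fun (j : Finset.Iic t) y => if (j : ℕ) < τ then (1 : ℝ) else
    gaussianRatio μ ⟨σ ^ 2, sq_nonneg σ⟩ y)]
  refine Finset.prod_eq_one fun j _ => ?_
  split_ifs
  · simp
  · exact (integral_gaussianRatio μ (mk_sq_ne_zero hσ)).2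

/-- The moments of the stream likelihood ratio are powers of those of a single observation, one
factor for each post-change observation. -/
theorem integral_streamRatio_rpow (μ : ℝ) {σ : ℝ} (τ t : ℕ) {s : ℝ}
    (hi : Integrable (fun x => gaussianRatio μ ⟨σ ^ 2, sq_nonneg σ⟩ x ^ s) (gaussianReal 0 1)) :
    Integrable (fun x => streamRatio μ σ τ t x ^ s)
      (Measure.pi (fun _ : Finset.Iic t => gaussianReal 0 1)) ∧
    ∫ x, streamRatio μ σ τ t x ^ s ∂(Measure.pi (fun _ : Finset.Iic t => gaussianReal 0 1))
      = (∫ x, gaussianRatio μ ⟨σ ^ 2, sq_nonneg σ⟩ x ^ s ∂(gaussianReal 0 1)) ^ (t + 1 - τ) := by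
  have e : ∀ x, streamRatio μ σ τ t x ^ s = ∏ j : Finset.Iic t,
      (if (j : ℕ) < τ then (1 : ℝ) else gaussianRatio μ ⟨σ ^ 2, sq_nonneg σ⟩ (x j) ^ s) :=
    fun x => by
      rw [streamRatio, ← Real.finsetProd_rpow _ _
        fun (j : Finset.Iic t) _ => streamRatio_factor_nonneg μ σ τ j (x j)]
      refine Finset.prod_congr rfl fun j _ => ?_
      split_ifs
      · exact Real.one_rpow s
      · rfl
  simp_rw [e]
  constructor
  · refine Integrable.fintype_prod_dep (f := fun (j : Finset.Iic t) y => if (j : ℕ) < τ then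
      (1 : ℝ) else gaussianRatio μ ⟨σ ^ 2, sq_nonneg σ⟩ y ^ s) fun j => ?_
    split_ifs
    · exact integrable_const _
    · exact hi
  · rw [integral_fintype_prod_eq_prod (fun (j : Finset.Iic t) y => if (j : ℕ) < τ then (1 : ℝ)
      else gaussianRatio μ ⟨σ ^ 2, sq_nonneg σ⟩ y ^ s)]
    have e2 : ∀ j : Finset.Iic t, ∫ y, (if (j : ℕ) < τ then (1 : ℝ) else
        gaussianRatio μ ⟨σ ^ 2, sq_nonneg σ⟩ y ^ s) ∂(gaussianReal 0 1) = if (j : ℕ) < τ then 1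
        else ∫ y, gaussianRatio μ ⟨σ ^ 2, sq_nonneg σ⟩ y ^ s ∂(gaussianReal 0 1) := fun j => by
      split_ifs <;> simp
    simp_rw [e2]
    rw [Finset.prod_coe_sort (Finset.Iic t) (fun j => if j < τ then (1 : ℝ) else
      ∫ y, gaussianRatio μ ⟨σ ^ 2, sq_nonneg σ⟩ y ^ s ∂(gaussianReal 0 1)), Finset.prod_ite,
      Finset.prod_const_one, one_mul, Finset.prod_const]
    congr 1
    have : (Finset.Iic t).filter (fun j => ¬ j < τ) = Finset.Icc τ t := by
      ext j; simp only [Finset.mem_filter, Finset.mem_Iic, Finset.mem_Icc]; omega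
    rw [this, Nat.card_Icc]

/-! ### Comparison of the two hypotheses up to time `t` -/

/-- The alternative is a product of mixtures. -/
theorem lawH1_eq_pi {N : ℕ} {p : ℝ} (hp0 : 0 ≤ p) (hp1 : p ≤ 1) (μ σ : ℝ) (τ : ℕ) :
    lawH1 N p μ σ τ = Measure.pi (fun _ : Fin N =>
      ENNReal.ofReal (1 - p) • nullStream + ENNReal.ofReal p • changedStream μ σ τ) :=
  (pi_mixture nullStream (changedStream μ σ τ) hp0 hp1 N).symm

/-- Extension by zero of a stream observed up to time `t`. -/
def extendZero (t : ℕ) (y : Finset.Iic t → ℝ) (j : ℕ) : ℝ :=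
  if h : j ∈ Finset.Iic t then y ⟨j, h⟩ else 0

theorem measurable_extendZero (t : ℕ) : Measurable (extendZero t) := by
  refine measurable_pi_lambda _ fun j => ?_
  by_cases h : j ∈ Finset.Iic t
  · simp only [extendZero, h, dite_true]; exact measurable_pi_apply _
  · simp only [extendZero, h, dite_false]; exact measurable_const

/-- A stream and the zero-extension of its restriction agree up to time `t`, so pulling `E` back
along the extension gives `E'`. -/
theorem exists_event_eq_preimage {N t : ℕ} {E : Set (Fin N → ℕ → ℝ)} (hE : MeasurableSet E)
    (hdep : ∀ X Y : Fin N → ℕ → ℝ, (∀ n, ∀ j ≤ t, X n j = Y n j) → (X ∈ E ↔ Y ∈ E)) :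
    ∃ E' : Set (Fin N → Finset.Iic t → ℝ), MeasurableSet E' ∧
      E = (fun X n => (Finset.Iic t).restrict (X n)) ⁻¹' E' := by
  refine ⟨(fun Y n => extendZero t (Y n)) ⁻¹' E, ?_, ?_⟩
  · exact hE.preimage (measurable_pi_lambda _ fun n =>
      (measurable_extendZero t).comp (measurable_pi_apply n))
  · ext X
    refine hdep _ _ fun n j hj => ?_
    simp [extendZero, hj]

theorem pi_real_preimage_restrict {N t : ℕ} (Q : Measure (ℕ → ℝ)) [IsProbabilityMeasure Q]
    {E' : Set (Fin N → Finset.Iic t → ℝ)} (hE' : MeasurableSet E') :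
    (Measure.pi (fun _ : Fin N => Q)).real
        ((fun X n => (Finset.Iic t).restrict (X n)) ⁻¹' E')
      = (Measure.pi (fun _ : Fin N => Q.map (Finset.Iic t).restrict)).real E' := by
  have hm : Measurable ((Finset.Iic t).restrict (π := fun _ : ℕ => ℝ)) :=
    Finset.measurable_restrict _
  have : IsProbabilityMeasure (Q.map (Finset.Iic t).restrict) :=
    Measure.isProbabilityMeasure_map hm.aemeasurable
  rw [← Measure.pi_map_pi (fun _ => hm.aemeasurable), map_measureReal_apply _ hE']
  exact measurable_pi_lambda _ fun n => hm.comp (measurable_pi_apply n)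

theorem isProbabilityMeasure_mixture {Ω : Type*} [MeasurableSpace Ω] (Q₀ Q₁ : Measure Ω)
    [IsProbabilityMeasure Q₀] [IsProbabilityMeasure Q₁] {p : ℝ} (hp0 : 0 ≤ p) (hp1 : p ≤ 1) :
    IsProbabilityMeasure (ENNReal.ofReal (1 - p) • Q₀ + ENNReal.ofReal p • Q₁) := by
  constructor
  simp only [Measure.add_apply, Measure.smul_apply, measure_univ, smul_eq_mul, mul_one]
  rw [← ENNReal.ofReal_add (by linarith) hp0]
  simp

/-- Moves the comparison to finitely many coordinates, where the changed stream has a density with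
respect to the null one. -/
theorem lawH1_real_sub_lawH0_real {N t : ℕ} {p : ℝ} (hp0 : 0 ≤ p) (hp1 : p ≤ 1) (μ σ : ℝ) (τ : ℕ)
    {E' : Set (Fin N → Finset.Iic t → ℝ)} (hE' : MeasurableSet E') :
    (lawH1 N p μ σ τ).real ((fun X n => (Finset.Iic t).restrict (X n)) ⁻¹' E')
      - (lawH0 N).real ((fun X n => (Finset.Iic t).restrict (X n)) ⁻¹' E')
    = (Measure.pi (fun _ : Fin N => ENNReal.ofReal (1 - p) •
          Measure.pi (fun _ : Finset.Iic t => gaussianReal 0 1) +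
          ENNReal.ofReal p • (changedStream μ σ τ).map (Finset.Iic t).restrict)).real E'
      - (Measure.pi (fun _ : Fin N =>
          Measure.pi (fun _ : Finset.Iic t => gaussianReal 0 1))).real E' := by
  have := isProbabilityMeasure_mixture nullStream (changedStream μ σ τ) hp0 hp1
  rw [lawH1_eq_pi hp0 hp1, lawH0, pi_real_preimage_restrict _ hE',
    pi_real_preimage_restrict _ hE', Measure.map_add _ _ (Finset.measurable_restrict _),
    Measure.map_smul, Measure.map_smul, map_restrict_nullStream]

/-- Before the change the two hypotheses agree. -/
theorem lawH1_real_sub_lawH0_real_eq_zero {N t : ℕ} {p : ℝ} (hp0 : 0 ≤ p) (hp1 : p ≤ 1) (μ σ : ℝ)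
    {τ : ℕ} (h : t < τ) {E' : Set (Fin N → Finset.Iic t → ℝ)} (hE' : MeasurableSet E') :
    (lawH1 N p μ σ τ).real ((fun X n => (Finset.Iic t).restrict (X n)) ⁻¹' E')
      - (lawH0 N).real ((fun X n => (Finset.Iic t).restrict (X n)) ⁻¹' E') = 0 := by
  rw [lawH1_real_sub_lawH0_real hp0 hp1 μ σ τ hE', map_restrict_changedStream_of_lt μ σ h,
    ← add_smul, ← ENNReal.ofReal_add (by linarith) hp0]
  simp

/-- Distance of the two hypotheses on events observed up to time `t`, in terms of a moment of the
likelihood ratio of one observation. -/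
theorem abs_lawH1_real_sub_lawH0_real_le {N t : ℕ} {p : ℝ} (hp0 : 0 ≤ p) (hp1 : p ≤ 1) (μ : ℝ)
    {σ : ℝ} (hσ : 0 < σ) (τ : ℕ) {s : ℝ} (hs1 : 1 ≤ s) (hs2 : s ≤ 2)
    (hi : Integrable (fun x => gaussianRatio μ ⟨σ ^ 2, sq_nonneg σ⟩ x ^ s) (gaussianReal 0 1))
    {E' : Set (Fin N → Finset.Iic t → ℝ)} (hE' : MeasurableSet E') {B : ℝ}
    (hB : N * (p ^ s * (∫ x, gaussianRatio μ ⟨σ ^ 2, sq_nonneg σ⟩ x ^ s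
      ∂(gaussianReal 0 1)) ^ (t + 1 - τ)) ≤ B) :
    |(lawH1 N p μ σ τ).real ((fun X n => (Finset.Iic t).restrict (X n)) ⁻¹' E')
      - (lawH0 N).real ((fun X n => (Finset.Iic t).restrict (X n)) ⁻¹' E')|
    ≤ Real.sqrt (Real.exp B - 1 + 2 * B) := by
  rw [lawH1_real_sub_lawH0_real hp0 hp1 μ σ τ hE', map_restrict_changedStream μ hσ]
  obtain ⟨h1, h2⟩ := integral_streamRatio μ hσ τ t
  obtain ⟨h3, h4⟩ := integral_streamRatio_rpow μ τ t hi
  refine (abs_pi_mixture_sub_le _ (measurable_streamRatio μ σ τ t) (streamRatio_nonneg μ σ τ t)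
    h1 h2 hp0 hp1 hs1 hs2 h3 N hE').trans (Real.sqrt_le_sqrt ?_)
  rw [h4]
  have := Real.exp_le_exp.2 hB
  linarith

/-! ### Calibration and conclusion -/

theorem exp_meanShift_sq {r : ℝ} (hr : 0 < r) {N : ℕ} (hN : 1 ≤ N) (c : ℝ) :
    Real.exp (meanShift r N ^ 2 / 2 * c) = (N : ℝ) ^ (r * c) := by
  have h1 : (1 : ℝ) ≤ N := by exact_mod_cast hN
  rw [meanShift, Real.sq_sqrt (by have := Real.log_nonneg h1; positivity),
    Real.rpow_def_of_pos (by linarith)]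
  congr 1
  ring

/-- The calibrated moment bound, uniformly in the number `m ≤ M` of post-change observations. -/
theorem calibrated_moment_le {r β s c C : ℝ} (hr : 0 < r) (hc : 0 ≤ c) (hC : 0 ≤ C) {m M N : ℕ}
    (hm : m ≤ M) (hN : 1 ≤ N) :
    N * (sparsity β N ^ s * (C * Real.exp (meanShift r N ^ 2 / 2 * c)) ^ m)
      ≤ max C 1 ^ M * (N : ℝ) ^ (1 - β * s + r * M * c) := by
  have h1 : (1 : ℝ) ≤ N := by exact_mod_cast hN
  have h0 : (0 : ℝ) < N := by linarith
  rw [exp_meanShift_sq hr hN, sparsity, ← Real.rpow_mul h0.le]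
  have hx : 1 ≤ (N : ℝ) ^ (r * c) := Real.one_le_rpow h1 (by positivity)
  -- Replacing `C` by `max C 1` makes the base at least `1`, so the power is monotone in `m`.
  have key : (C * (N : ℝ) ^ (r * c)) ^ m ≤ max C 1 ^ M * (N : ℝ) ^ (r * M * c) := by
    calc (C * (N : ℝ) ^ (r * c)) ^ m ≤ (max C 1 * (N : ℝ) ^ (r * c)) ^ m := by
          gcongr; exact le_max_left _ _
      _ ≤ (max C 1 * (N : ℝ) ^ (r * c)) ^ M :=
          pow_le_pow_right₀ (one_le_mul_of_one_le_of_one_le (le_max_right _ _) hx) hm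
      _ = max C 1 ^ M * (N : ℝ) ^ (r * M * c) := by
          rw [mul_pow, ← Real.rpow_mul_natCast h0.le]; ring_nf
  calc (N : ℝ) * ((N : ℝ) ^ (-β * s) * (C * (N : ℝ) ^ (r * c)) ^ m)
      ≤ (N : ℝ) * ((N : ℝ) ^ (-β * s) * (max C 1 ^ M * (N : ℝ) ^ (r * M * c))) := by gcongr
    _ = max C 1 ^ M * (N : ℝ) ^ (1 - β * s + r * M * c) := by
        rw [Real.rpow_add h0, sub_eq_add_neg, Real.rpow_add h0, Real.rpow_one, neg_mul]
        ring

theorem sparsity_mem_Icc {β : ℝ} (hβ : 0 ≤ β) {N : ℕ} (hN : 1 ≤ N) :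
    0 ≤ sparsity β N ∧ sparsity β N ≤ 1 :=
  ⟨Real.rpow_nonneg (Nat.cast_nonneg _) _,
    Real.rpow_le_one_of_one_le_of_nonpos (by exact_mod_cast hN) (by linarith)⟩

end SparseChange

theorem theorem1
    (kind : TestKind) (r β σ : ℝ) (hr : 0 < r) (hβ : 1 / 2 < β) (hβ' : β < 1) (hσ : 0 < σ)
    -- the horizon
    (H : ℕ → ℕ) (hH : Tendsto (fun N : ℕ => (H N : ℝ) / Real.log N) atTop (𝓝 0))
    -- the window length of the GLR statistic
    (w : ℕ → ℕ+)
    -- the global test statistics and the array of thresholds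
    (U : (N : ℕ) → ℕ → (Fin N → ℝ) → ℝ) (hU : ∀ N s, Measurable (U N s))
    (b : ℕ → ℕ → ℝ)
    -- the change-point and the time of interest
    (τ t : ℕ → ℕ) (hτ : ∀ᶠ N in atTop, 1 ≤ τ N ∧ τ N ≤ H N)
    (ht : ∀ᶠ N in atTop, t N < τ N ∨ t N + 1 < τ N + deltaStar r β σ) :
    Tendsto (fun N : ℕ =>
        (lawH1 N (sparsity β N) (meanShift r N) σ (τ N)).real
          {X | stopTime kind (meanShift r N) (w N) (H N) (U N) (b N) X ≤ (t N : ℕ∞)}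
        - (lawH0 N).real
          {X | stopTime kind (meanShift r N) (w N) (H N) (U N) (b N) X ≤ (t N : ℕ∞)})
      atTop (𝓝 0) := by
  have hevent : ∀ N, ∃ E' : Set (Fin N → Finset.Iic (t N) → ℝ), MeasurableSet E' ∧
      {X | stopTime kind (meanShift r N) (w N) (H N) (U N) (b N) X ≤ (t N : ℕ∞)}
        = (fun X n => (Finset.Iic (t N)).restrict (X n)) ⁻¹' E' := fun N =>
    exists_event_eq_preimage
      (measurableSet_stopTime_le kind (meanShift r N) (w N) (H N) (hU N) (b N) (t N))
      fun X Y h => stopTime_le_congr kind (meanShift r N) (w N) (H N) (U N) (b N) h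
  choose E' hE' hEE' using hevent
  simp_rw [hEE']
  rcases Nat.eq_zero_or_pos (deltaStar r β σ) with hΔ | hΔ
  -- If `Δ* = 0`, both alternatives in `ht` say `t < τ`, and the difference is exactly `0`.
  · refine tendsto_const_nhds.congr' ?_
    filter_upwards [ht, eventually_ge_atTop 1] with N htN hN
    obtain ⟨hp0, hp1⟩ := sparsity_mem_Icc (β := β) (by linarith) hN
    exact (lawH1_real_sub_lawH0_real_eq_zero hp0 hp1 _ σ (by omega) (hE' N)).symm
  -- `M = Δ* - 1` is the largest admissible number of post-change observations; the ceiling gives `r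
  -- M < ρ*`.
  · obtain ⟨M, hM⟩ : ∃ M, deltaStar r β σ = M + 1 := ⟨_, (Nat.sub_add_cancel hΔ).symm⟩
    have hR : r * M < rhoStar β σ := by
      have h : (M : ℝ) < rhoStar β σ / r := Nat.lt_ceil.1 (by rw [← deltaStar, hM]; omega)
      rw [lt_div_iff₀ hr] at h
      linarith
    obtain ⟨s, hs1, hs2, hD, hneg⟩ := exists_moment_order hβ' hσ (by positivity) hR
    set c := s * (s - 1) / (s - σ ^ 2 * (s - 1))
    have hc0 : 0 ≤ c := div_nonneg (mul_nonneg (by linarith) (by linarith)) hD.le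
    obtain ⟨C, hC⟩ := exists_gaussianRatio_moment (mk_sq_ne_zero hσ) hD
    have hC0 : 0 ≤ C := by
      have h := (hC 0).2
      have h' : 0 ≤ ∫ x, gaussianRatio 0 ⟨σ ^ 2, sq_nonneg σ⟩ x ^ s ∂(gaussianReal 0 1) :=
        integral_nonneg fun x => Real.rpow_nonneg (gaussianRatio_nonneg _ _ _) _
      rw [h] at h'
      exact nonneg_of_mul_nonneg_left h' (Real.exp_pos _)
    have hB : Tendsto (fun N : ℕ => max C 1 ^ M * (N : ℝ) ^ (1 - β * s + r * M * c)) atTop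
        (𝓝 0) := by
      have h := (tendsto_rpow_neg_atTop (neg_pos.2 hneg)).comp tendsto_natCast_atTop_atTop
      simpa [Function.comp_def] using h.const_mul (max C 1 ^ M)
    have hlim : Tendsto (fun N : ℕ => Real.sqrt
        (Real.exp (max C 1 ^ M * (N : ℝ) ^ (1 - β * s + r * M * c)) - 1
          + 2 * (max C 1 ^ M * (N : ℝ) ^ (1 - β * s + r * M * c)))) atTop (𝓝 0) := by
      have hcont : Continuous fun x : ℝ => Real.sqrt (Real.exp x - 1 + 2 * x) := by fun_prop
      have h := (hcont.tendsto 0).comp hB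
      simpa [Function.comp_def] using h
    refine squeeze_zero_norm' ?_ hlim
    filter_upwards [ht, eventually_ge_atTop 1] with N htN hN
    obtain ⟨hp0, hp1⟩ := sparsity_mem_Icc (β := β) (by linarith) hN
    obtain ⟨hi, hint⟩ := hC (meanShift r N)
    refine abs_lawH1_real_sub_lawH0_real_le hp0 hp1 _ hσ (τ N) hs1 hs2 hi (hE' N) ?_
    rw [hint]
    -- `t + 1 - τ ≤ M` in both alternatives of `ht`: the truncated subtraction is `0` before the
    -- change.
    exact calibrated_moment_le hr hc0 hC0 (by omega) hN
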